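/- Let $S\subseteq\mathbb N$ be a numerical semigroup (a submonoid of $(\mathbb N,+)$ with finite complement), let $k$ be a field, and let $R=k[\![S]\!]$ be the ring of power series in $k[\![t]\!]$ all of whose exponents lie in $S$, a local ring with maximal ideal $\mathfrak m$. Let $E$ be a principal ideal of $S$ with $0\notin E$, that is, $E=e+S$ for some $e\in S$, $e\ne 0$, and let $I=(t^x \mid x\in E)\subseteq R$ be the corresponding monomial ideal. For an ideal $\mathfrak a$ of a ring $A$ and an $A$-module $N$ write $\mathrm{gr}_{\mathfrak a}(A)=\bigoplus_{n\ge 0}\mathfrak a^n/\mathfrak a^{n+1}$ and $\mathrm{gr}_{\mathfrak a}(N)=\bigoplus_{n\ge 0}\mathfrak a^nN/\mathfrak a^{n+1}N$, a $\mathrm{gr}_{\mathfrak a}(A)$-module. A finite module $N$ over a Noetherian ring $A$ is Cohen--Macaulay if $\operatorname{depth} N_{\mathfrak p}=\dim N_{\mathfrak p}$ for every maximal ideal $\mathfrak p$ in the support of $N$, and $A$ is Cohen--Macaulay if it is so as a module over itself. (1) If $\mathrm{gr}_{\mathfrak m}(R)$ is Cohen--Macaulay, then $\mathrm{gr}_{\mathfrak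 m}(I)$ is a Cohen--Macaulay $\mathrm{gr}_{\mathfrak m}(R)$-module. (2) Let $b\in S$ be odd, let $S\Join^bE=\{2s\mid s\in S\}\cup\{2x+b\mid x\in E\}$ be the numerical duplication, and let $\mathfrak n$ be the maximal ideal of $D=k[\![S\Join^bE]\!]$. Then $\mathrm{gr}_{\mathfrak n}(D)$ is Cohen--Macaulay if and only if $\mathrm{gr}_{\mathfrak m}(R)$ is Cohen--Macaulay. -/

import Mathlib

open scoped PowerSeries

namespace TangentCone

/-! ### Associated graded rings and modules -/

section AssociatedGraded

universe u

variable {A : Type u} [CommRing A]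

/-- The ideal `⨁ₙ Iⁿ⁺¹ Tⁿ` of the Rees algebra `A[IT] = ⨁ₙ Iⁿ Tⁿ`. -/
def reesShift (I : Ideal A) : Ideal (reesAlgebra I) where
  carrier := { f | ∀ i, (f : Polynomial A).coeff i ∈ I ^ (i + 1) }
  add_mem' hf hg i := by
    simpa using add_mem (hf i) (hg i)
  zero_mem' i := by simp
  smul_mem' r f hf i := by
    simp only [smul_eq_mul, MulMemClass.coe_mul, Polynomial.coeff_mul]
    refine Ideal.sum_mem _ ?_
    rintro ⟨j, l⟩ e
    rw [← Finset.HasAntidiagonal.mem_antidiagonal.mp e, add_assoc, pow_add]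
    exact Ideal.mul_mem_mul (r.2 j) (hf l)

/-- The associated graded ring `gr_I(A) = ⨁ₙ Iⁿ / Iⁿ⁺¹`, as the quotient of `⨁ₙ Iⁿ Tⁿ` by the
homogeneous ideal `⨁ₙ Iⁿ⁺¹ Tⁿ`. -/
abbrev AssocGradedRing (I : Ideal A) : Type u := reesAlgebra I ⧸ reesShift I

variable (I : Ideal A) (N : Type u) [AddCommGroup N] [Module A N]

/-- The Rees module `⨁ₙ Iⁿ N Tⁿ`, a module over the Rees algebra `⨁ₙ Iⁿ Tⁿ`. -/
def ReesModule : Type u := ↥((I.stableFiltration (⊤ : Submodule A N)).submodule)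

noncomputable instance : AddCommGroup (ReesModule I N) :=
  inferInstanceAs (AddCommGroup ↥((I.stableFiltration (⊤ : Submodule A N)).submodule))

noncomputable instance : Module (reesAlgebra I) (ReesModule I N) :=
  inferInstanceAs (Module (reesAlgebra I) ↥((I.stableFiltration (⊤ : Submodule A N)).submodule))

/-- The inclusion of the Rees module into `N[T]`. -/
noncomputable def ReesModule.toPolynomialModule :
    ReesModule I N →ₗ[reesAlgebra I] PolynomialModule A N :=
  ((I.stableFiltration (⊤ : Submodule A N)).submodule).subtype

/-- The submodule `⨁ₙ Iⁿ⁺¹ N Tⁿ` of the Rees module `⨁ₙ Iⁿ N Tⁿ`. -/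
noncomputable def reesModuleShift : Submodule (reesAlgebra I) (ReesModule I N) :=
  ((I.stableFiltration (I • (⊤ : Submodule A N))).submodule).comap
    (ReesModule.toPolynomialModule I N)

/-- The associated graded module `gr_I(N) = ⨁ₙ Iⁿ N / Iⁿ⁺¹ N`, as the quotient of `⨁ₙ Iⁿ N Tⁿ` by
`⨁ₙ Iⁿ⁺¹ N Tⁿ`. -/
abbrev AssocGradedModule : Type u := ReesModule I N ⧸ reesModuleShift I N

theorem ReesModule.coeff_mem (f : ReesModule I N) (i : ℕ) :
    (toPolynomialModule I N f).coeff i ∈ I ^ i • (⊤ : Submodule A N) := f.2 i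

theorem mem_reesModuleShift (f : ReesModule I N) :
    f ∈ reesModuleShift I N ↔
      ∀ i, (ReesModule.toPolynomialModule I N f).coeff i ∈
        I ^ (i + 1) • (⊤ : Submodule A N) := by
  simp [reesModuleShift, pow_succ, Submodule.mul_smul]

theorem reesShift_smul_mem (r : reesAlgebra I) (hr : r ∈ reesShift I) (f : ReesModule I N) :
    r • f ∈ reesModuleShift I N := by
  rw [mem_reesModuleShift]
  intro i
  rw [map_smul, Subalgebra.smul_def, PolynomialModule.smul_apply]
  refine Submodule.sum_mem _ ?_
  rintro ⟨j, l⟩ e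
  rw [Finset.HasAntidiagonal.mem_antidiagonal] at e
  subst e
  have h := Submodule.smul_mem_smul (hr j) (ReesModule.coeff_mem I N f l)
  rw [← Submodule.mul_smul, ← pow_add] at h
  rwa [add_right_comm]

theorem assocGradedModule_isTorsion :
    Module.IsTorsionBySet (reesAlgebra I) (AssocGradedModule I N) (reesShift I) := by
  rintro x ⟨r, hr⟩
  induction x using Submodule.Quotient.induction_on with
  | H f =>
    exact (Submodule.Quotient.mk_eq_zero _).2 (reesShift_smul_mem I N r hr f)

/-- The action of `gr_I(A)` on `gr_I(N)` induced by the action of `⨁ₙ Iⁿ Tⁿ` on `⨁ₙ Iⁿ N Tⁿ`. -/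
noncomputable instance : Module (AssocGradedRing I) (AssocGradedModule I N) :=
  (assocGradedModule_isTorsion I N).module

theorem assocGradedRing_mk_smul_mk (r : reesAlgebra I) (f : ReesModule I N) :
    (Ideal.Quotient.mk (reesShift I) r) • (Submodule.Quotient.mk f : AssocGradedModule I N) =
      Submodule.Quotient.mk (r • f) := rfl

end AssociatedGraded

/-! ### Cohen–Macaulay rings and modules -/

section CohenMacaulay

/-- The depth of a module `N` over a local ring `A`: the supremum of the lengths of the
`N`-regular sequences in the maximal ideal. -/
noncomputable def depth (A : Type*) [CommRing A] [IsLocalRing A]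
    (N : Type*) [AddCommGroup N] [Module A N] : ℕ∞ :=
  ⨆ rs ∈ { rs : List A | (∀ r ∈ rs, r ∈ IsLocalRing.maximalIdeal A) ∧
    RingTheory.Sequence.IsRegular N rs }, (rs.length : ℕ∞)

/-- A finite module `N` over a Noetherian ring `A` is Cohen–Macaulay if
`depth N_p = dim N_p` for every maximal ideal `p` in the support of `N`. -/
structure IsCohenMacaulayModule (A : Type*) [CommRing A]
    (N : Type*) [AddCommGroup N] [Module A N] : Prop where
  noetherian : IsNoetherianRing A
  finite : Module.Finite A N
  depth_eq_dim : ∀ p : PrimeSpectrum A, p.asIdeal.IsMaximal → p ∈ Module.support A N →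
    (depth (Localization.AtPrime p.asIdeal)
        (LocalizedModule p.asIdeal.primeCompl N) : WithBot ℕ∞) =
      Module.supportDim (Localization.AtPrime p.asIdeal)
        (LocalizedModule p.asIdeal.primeCompl N)

/-- A ring is Cohen–Macaulay if it is a Cohen–Macaulay module over itself. -/
def IsCohenMacaulayRing (A : Type*) [CommRing A] : Prop := IsCohenMacaulayModule A A

end CohenMacaulay

/-! ### Numerical semigroups and their rings -/

section Semigroup

/-- A numerical semigroup is a submonoid of `ℕ` with finite complement. -/
def IsNumericalSemigroup (S : AddSubmonoid ℕ) : Prop := ((S : Set ℕ)ᶜ).Finite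

/-- An ideal of the semigroup `S` is principal if it is of the form `e + S`. -/
def IsPrincipal {S : AddSubmonoid ℕ} (E : AddSemigroupIdeal S) : Prop :=
  ∃ e : S, E = AddSemigroupIdeal.closure {e}

/-- The numerical duplication `2 · S ∪ (2 · E + b)`. -/
def numericalDuplication (S : AddSubmonoid ℕ) (E : AddSemigroupIdeal S) (b : S) :
    AddSubmonoid ℕ where
  carrier := { n | ∃ s : S, n = 2 * (s : ℕ) } ∪ { n | ∃ e ∈ E, n = 2 * (e : ℕ) + b }
  zero_mem' := Or.inl ⟨0, by simp⟩
  add_mem' := by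
    rintro _ _ (⟨s, rfl⟩ | ⟨e, he, rfl⟩) (⟨s', rfl⟩ | ⟨e', he', rfl⟩)
    · exact Or.inl ⟨s + s', by push_cast; ring⟩
    · exact Or.inr ⟨s + e', E.add_mem s he', by push_cast; ring⟩
    · exact Or.inr ⟨s' + e, E.add_mem s' he, by push_cast; ring⟩
    · exact Or.inl ⟨e + e' + b, by push_cast; ring⟩

variable (k : Type*) [Field k] (S : AddSubmonoid ℕ)

/-- The subalgebra of `k⟦t⟧` of the power series all of whose exponents lie in `S`. -/
def semigroupSubalgebra : Subalgebra k k⟦X⟧ where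
  carrier := { f | ∀ n, n ∉ S → PowerSeries.coeff n f = 0 }
  add_mem' hf hg n hn := by simp [hf n hn, hg n hn]
  mul_mem' {f g} hf hg n hn := by
    rw [PowerSeries.coeff_mul]
    refine Finset.sum_eq_zero ?_
    rintro ⟨i, j⟩ hij
    rw [Finset.HasAntidiagonal.mem_antidiagonal] at hij
    by_cases hi : i ∈ S
    · have hj : j ∉ S := fun hj => hn (hij ▸ S.add_mem hi hj)
      simp [hg j hj]
    · simp [hf i hi]
  algebraMap_mem' r n hn := by
    have h0 : n ≠ 0 := fun h => hn (h ▸ S.zero_mem)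
    simp [PowerSeries.coeff_C, h0]

variable {k S}

theorem inv_mem_semigroupSubalgebra {f : k⟦X⟧} (hf : f ∈ semigroupSubalgebra k S) :
    f⁻¹ ∈ semigroupSubalgebra k S := by
  intro n
  induction n using Nat.strong_induction_on with
  | _ n ih =>
    intro hn
    have h0 : n ≠ 0 := fun h => hn (h ▸ S.zero_mem)
    rw [PowerSeries.coeff_inv, if_neg h0]
    refine mul_eq_zero_of_right _ (Finset.sum_eq_zero ?_)
    rintro ⟨i, j⟩ hij
    rw [Finset.HasAntidiagonal.mem_antidiagonal] at hij
    split_ifs with hj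
    · by_cases hi : i ∈ S
      · have hjS : j ∉ S := fun h => hn (hij ▸ S.add_mem hi h)
        simp [ih j hj hjS]
      · simp [hf i hi]
    · rfl

variable (k S) in
/-- The semigroup ring `k⟦S⟧` of the power series in `k⟦t⟧` all of whose exponents lie in `S`. -/
def SemigroupRing : Type _ := ↥(semigroupSubalgebra k S)

noncomputable instance : CommRing (SemigroupRing k S) :=
  inferInstanceAs (CommRing ↥(semigroupSubalgebra k S))

noncomputable instance : Algebra k (SemigroupRing k S) :=
  inferInstanceAs (Algebra k ↥(semigroupSubalgebra k S))

/-- The inclusion of `k⟦S⟧` into `k⟦t⟧`. -/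
noncomputable def SemigroupRing.toPowerSeries : SemigroupRing k S →ₐ[k] k⟦X⟧ :=
  (semigroupSubalgebra k S).val

theorem SemigroupRing.isUnit_iff (f : SemigroupRing k S) :
    IsUnit f ↔ PowerSeries.constantCoeff (toPowerSeries f) ≠ 0 := by
  constructor
  · intro h
    exact ((h.map (toPowerSeries (k := k) (S := S))).map PowerSeries.constantCoeff).ne_zero
  · intro h
    exact IsUnit.of_mul_eq_one ⟨_, inv_mem_semigroupSubalgebra f.2⟩
      (Subtype.ext (PowerSeries.mul_inv_cancel _ h))

instance : Nontrivial (SemigroupRing k S) :=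
  (SemigroupRing.toPowerSeries (k := k) (S := S)).toRingHom.domain_nontrivial

instance : IsLocalRing (SemigroupRing k S) :=
  IsLocalRing.of_nonunits_add fun f g hf hg => by
    simp only [mem_nonunits_iff, SemigroupRing.isUnit_iff, not_not] at hf hg ⊢
    simp [hf, hg]

variable (k) in
/-- The monomial ideal `(tᵉ | e ∈ E)` of `k⟦S⟧`. -/
noncomputable def monomialIdeal (E : AddSemigroupIdeal S) : Ideal (SemigroupRing k S) :=
  Ideal.span { f | ∃ e ∈ E, SemigroupRing.toPowerSeries f = PowerSeries.X ^ (e : ℕ) }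

end Semigroup

end TangentCone

/-! Write `M` for the nonzero elements of `S`, `ord s` for the largest `n` with `s ∈ nM`, and `m`
for the least element of `M`. The initial forms `b s` of the monomials `tˢ` are a `k`-basis of
`gr_𝔪(R)`, with `b s * b t = b (s + t)` when `ord` is additive on `s, t` and `0` otherwise.
Everything about this ring can therefore be read off from `ord`.

The key is a numerical criterion, `IsMonomialBasis.isCohenMacaulayRing_iff`: the ring is
Cohen–Macaulay iff `ord (s + m) = ord s + 1` for all `s`. The ring is finite over `k[b m]`, so it
has dimension at most one. If the equality holds, every nonzero polynomial in `b m` is a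
nonzerodivisor, and each maximal ideal contains such an element. If it fails, it fails only finitely
often, and the largest failure `s` makes `b s` a socle element at the ideal of positive degree; the
depth there is zero, while `b m` is not nilpotent, so the dimension is positive.

For the duplication, the multiplicity is `2m`, and the orders of `2s` and `2s + (2e + b)` are `ord
s` and `ord s + 1`, so the criteria for `D` and `R` coincide. For the module statement, the ideal is
generated by the nonzerodivisor `tᵉ`, hence is free of rank one, and its graded module is isomorphic
to `gr_𝔪(R)`. -/

namespace TangentCone

/-! ### Depth and Cohen–Macaulayness: invariance and local criteria -/

section CohenMacaulayTransfer

theorem depth_eq_of_equiv {A : Type*} [CommRing A] [IsLocalRing A] {N N' : Type*}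
    [AddCommGroup N] [Module A N] [AddCommGroup N'] [Module A N'] (e : N ≃ₗ[A] N') :
    depth A N = depth A N' := by
  simp only [depth, Set.mem_ofPred_eq, e.isRegular_congr]

theorem IsCohenMacaulayModule.of_equiv {A : Type*} [CommRing A] {N N' : Type*}
    [AddCommGroup N] [Module A N] [AddCommGroup N'] [Module A N'] (e : N ≃ₗ[A] N')
    (h : IsCohenMacaulayModule A N) : IsCohenMacaulayModule A N' where
  noetherian := h.noetherian
  finite := have := h.finite; Module.Finite.equiv e
  depth_eq_dim p hp hs := by
    have e' := IsLocalizedModule.mapEquiv p.asIdeal.primeCompl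
      (LocalizedModule.mkLinearMap p.asIdeal.primeCompl N)
      (LocalizedModule.mkLinearMap p.asIdeal.primeCompl N')
      (Localization.AtPrime p.asIdeal) e
    rw [← depth_eq_of_equiv e', ← Module.supportDim_eq_of_equiv e']
    exact h.depth_eq_dim p hp (by rwa [e.support_eq])

theorem isCohenMacaulayRing_iff {A : Type*} [CommRing A] :
    IsCohenMacaulayRing A ↔ IsNoetherianRing A ∧ ∀ (p : Ideal A) [p.IsMaximal],
      (depth (Localization.AtPrime p) (Localization.AtPrime p) : WithBot ℕ∞) =
        ringKrullDim (Localization.AtPrime p) := by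
  have key (p : Ideal A) [p.IsPrime] :
      ((depth (Localization.AtPrime p) (LocalizedModule p.primeCompl A) : WithBot ℕ∞) =
        Module.supportDim (Localization.AtPrime p) (LocalizedModule p.primeCompl A)) ↔
      (depth (Localization.AtPrime p) (Localization.AtPrime p) : WithBot ℕ∞) =
        ringKrullDim (Localization.AtPrime p) := by
    have e := (IsLocalizedModule.linearEquiv p.primeCompl
      (LocalizedModule.mkLinearMap p.primeCompl A)
      (Algebra.linearMap A (Localization.AtPrime p))).extendScalarsOfIsLocalization
        p.primeCompl (Localization.AtPrime p)
    rw [depth_eq_of_equiv e, Module.supportDim_eq_of_equiv e, Module.supportDim_self_eq_ringKrullDim]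
  constructor
  · intro h
    refine ⟨h.noetherian, fun p hp => (key p).1 (h.depth_eq_dim ⟨p, hp.isPrime⟩ hp ?_)⟩
    rw [Module.mem_support_iff_exists_annihilator]
    refine ⟨1, fun a ha => ?_⟩
    rw [Submodule.mem_annihilator_span_singleton, smul_eq_mul, mul_one] at ha
    simp [ha]
  · rintro ⟨h1, h2⟩
    exact ⟨h1, inferInstance, fun p hp _ => (key p.asIdeal).2 (h2 p.asIdeal)⟩

variable {A : Type*} [CommRing A] [IsLocalRing A]

theorem length_le_ringKrullDim [IsNoetherianRing A] {rs : List A}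
    (h : RingTheory.Sequence.IsRegular A rs) : (rs.length : WithBot ℕ∞) ≤ ringKrullDim A := by
  rw [← Module.supportDim_self_eq_ringKrullDim,
    ← Module.supportDim_add_length_eq_supportDim_of_isRegular rs h]
  have := h.quot_ofList_smul_nontrivial
  have h0 : 0 ≤ Module.supportDim A (A ⧸ Ideal.ofList rs • (⊤ : Submodule A A)) :=
    Order.krullDim_nonneg_iff.2 Module.nonempty_support_of_nontrivial.to_subtype
  exact le_add_of_nonneg_left h0

/-- A Noetherian local ring of dimension at most one with a regular nonunit has depth equal to its
dimension. -/
theorem depth_eq_ringKrullDim_of_isSMulRegular [IsNoetherianRing A] (hdim : ringKrullDim A ≤ 1)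
    {y : A} (hy : y ∈ IsLocalRing.maximalIdeal A) (hreg : IsSMulRegular A y) :
    (depth A A : WithBot ℕ∞) = ringKrullDim A := by
  have hr : RingTheory.Sequence.IsRegular A [y] :=
    .of_isWeaklyRegular_of_mem_maximalIdeal A (by simpa using hy)
      ((RingTheory.Sequence.isWeaklyRegular_singleton_iff A y).2 hreg)
  have h1 : ringKrullDim A = 1 := le_antisymm hdim (by simpa using length_le_ringKrullDim hr)
  have h2 : (1 : ℕ∞) ≤ depth A A := by
    have : (([y] : List A).length : ℕ∞) ≤ depth A A :=
      le_iSup₂_of_le (f := fun (rs : List A) (_ : rs ∈ { rs : List A |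
        (∀ r ∈ rs, r ∈ IsLocalRing.maximalIdeal A) ∧ RingTheory.Sequence.IsRegular A rs }) =>
          (rs.length : ℕ∞)) [y] ⟨by simpa using hy, hr⟩ le_rfl
    simpa using this
  have h3 : depth A A ≤ 1 := by
    refine iSup₂_le fun rs hrs => ?_
    have := length_le_ringKrullDim hrs.2
    rw [h1] at this
    exact_mod_cast this
  rw [h1, le_antisymm h3 h2]
  rfl

/-- A nonzero socle element is killed by the first member of any nonempty sequence in the maximal
ideal. -/
theorem depth_eq_zero_of_mul_eq_zero {z : A} (hz : z ≠ 0)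
    (h : ∀ y ∈ IsLocalRing.maximalIdeal A, y * z = 0) : depth A A = 0 := by
  refine le_antisymm (iSup₂_le fun rs hrs => ?_) zero_le
  cases rs with
  | nil => simp
  | cons y l =>
    have hy := ((RingTheory.Sequence.isRegular_cons_iff A y l).1 hrs.2).1
    exact absurd (hy (by simpa using h y (hrs.1 y (by simp)) : y • z = y • 0)) hz

end CohenMacaulayTransfer

/-! ### Dimension bounds -/

section IntegralExtension

theorem ringKrullDim_le_of_isIntegral (R A : Type*) [CommRing R] [CommRing A] [Algebra R A]
    [Algebra.IsIntegral R A] : ringKrullDim A ≤ ringKrullDim R :=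
  Order.krullDim_le_of_strictMono (PrimeSpectrum.comap (algebraMap R A)) fun _ _ h =>
    Ideal.IsIntegral.comap_lt_comap h

theorem ringKrullDim_localization_le {A : Type*} [CommRing A] (p : Ideal A) [p.IsPrime] :
    ringKrullDim (Localization.AtPrime p) ≤ ringKrullDim A := by
  rw [IsLocalization.AtPrime.ringKrullDim_eq_height p]
  exact Ideal.height_le_ringKrullDim_of_ne_top (Ideal.IsPrime.ne_top ‹_›)

end IntegralExtension
end TangentCone

namespace TangentCone

/-! ### The Cohen–Macaulay criterion for algebras with a monomial basis -/

section MonomialBasis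

open Polynomial

/-- The properties of the order function `o` of a numerical semigroup `S` of multiplicity `m`. -/
structure IsOrderFunction (S : AddSubmonoid ℕ) (o : ℕ → ℕ) (m : S) : Prop where
  order_zero : o 0 = 0
  add_le : ∀ s t : S, o s + o t ≤ o (s + t : S)
  ne_zero : m ≠ 0
  map_mult : o m = 1
  mul_le : ∀ s : S, m * o s ≤ s
  cofinite : ∃ c, ∀ n ≥ c, n ∈ S

/-- A basis of an algebra indexed by `S` in which products are either zero or given by the addition
of `S`, according to whether the order function `o` is additive. -/
structure IsMonomialBasis {k : Type*} [Field k] {S : AddSubmonoid ℕ} (o : ℕ → ℕ) {G : Type*}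
    [CommRing G] [Algebra k G] (b : Module.Basis S k G) : Prop where
  basis_zero : b 0 = 1
  mul_of_eq : ∀ s t : S, o (s + t : S) = o s + o t → b s * b t = b (s + t)
  mul_of_ne : ∀ s t : S, o (s + t : S) ≠ o s + o t → b s * b t = 0

theorem eventually_const_of_antitone (f : ℕ → ℕ) (hf : Antitone f) :
    ∃ n, ∀ j ≥ n, f (j + 1) = f j := by
  obtain ⟨n, hn⟩ := WellFoundedGT.monotone_chain_condition (α := ℕᵒᵈ)
    ⟨fun j => OrderDual.toDual (f j), fun _ _ h => hf h⟩
  refine ⟨n, fun j hj => ?_⟩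
  have h1 : f n = f j := hn j hj
  have h2 : f n = f (j + 1) := hn (j + 1) (by omega)
  omega

variable {S : AddSubmonoid ℕ} {o : ℕ → ℕ} {m : S}

theorem IsOrderFunction.succ_le (ho : IsOrderFunction S o m) (s : S) :
    o s + 1 ≤ o (s + m : S) := by
  simpa [ho.map_mult] using ho.add_le s m

/-- Within a residue class modulo `m`, the defect `s - m * o s` is a natural number that never
increases when `m` is added, so it stabilises; a constant defect means that the order grows by
exactly one. Finitely many classes give a uniform bound. -/
theorem IsOrderFunction.exists_forall_ge (ho : IsOrderFunction S o m) :
    ∃ N, ∀ s ≥ N, s ∈ S ∧ o (s + m) = o s + 1 := by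
  obtain ⟨c, hc⟩ := ho.cofinite
  have hm : 0 < (m : ℕ) := Nat.pos_of_ne_zero fun h => ho.ne_zero (Subtype.ext h)
  have key (r : ℕ) : ∃ n, ∀ j ≥ n, o (c + r + j * m + m) = o (c + r + j * m) + 1 := by
    have hmem (j : ℕ) : c + r + j * m ∈ S := hc _ (by nlinarith)
    have hle (j : ℕ) := ho.mul_le ⟨_, hmem j⟩
    have hstep (j : ℕ) : o (c + r + j * m) + 1 ≤ o (c + r + (j + 1) * m) := by
      have := ho.succ_le ⟨_, hmem j⟩
      rwa [AddSubmonoid.coe_add, add_assoc (c + r), ← Nat.succ_mul] at this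
    have expand (j : ℕ) : c + r + (j + 1) * (m : ℕ) = c + r + j * m + m := by ring
    obtain ⟨n, hn⟩ := eventually_const_of_antitone
      (fun j => c + r + j * m - m * o (c + r + j * m)) (antitone_nat_of_succ_le fun j => by
        have h1 := Nat.mul_le_mul_left (m : ℕ) (hstep j)
        have h2 := hle j
        have h3 := hle (j + 1)
        have h4 := expand j
        simp only [mul_add, mul_one] at h1 h2 h3
        omega)
    refine ⟨n, fun j hj => ?_⟩
    have h1 := hn j hj
    have h2 := hle j
    have h3 := hle (j + 1)
    have h4 := expand j
    simp only at h1 h2 h3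
    have h5 : (m : ℕ) * o (c + r + (j + 1) * m) = m * (o (c + r + j * m) + 1) := by
      rw [mul_add, mul_one]
      omega
    rw [← h4]
    exact Nat.eq_of_mul_eq_mul_left hm h5
  choose n hn using key
  refine ⟨c + m + ((Finset.range m).sup n) * m, fun s hs => ⟨hc s (by omega), ?_⟩⟩
  have hlt := Nat.mod_lt (s - c) hm
  have h1 : n ((s - c) % m) ≤ (s - c) / m := by
    refine (Finset.le_sup (f := n) (Finset.mem_range.2 hlt)).trans ?_
    rw [Nat.le_div_iff_mul_le hm]
    omega
  have h2 := hn ((s - c) % m) _ h1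
  have h3 : c + (s - c) % m + (s - c) / m * m = s := by
    have := Nat.mod_add_div' (s - c) m
    omega
  rwa [h3] at h2

theorem IsOrderFunction.map_nsmul (ho : IsOrderFunction S o m) (n : ℕ) :
    o ((n • m : S) : ℕ) = n := by
  have hm : 0 < (m : ℕ) := Nat.pos_of_ne_zero fun h => ho.ne_zero (Subtype.ext h)
  refine le_antisymm ?_ ?_
  · have := ho.mul_le (n • m)
    simp only [AddSubmonoidClass.coe_nsmul, smul_eq_mul] at this ⊢
    exact Nat.le_of_mul_le_mul_left (by linarith) hm
  · induction n with
    | zero => simp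
    | succ n ih =>
      rw [succ_nsmul]
      exact (Nat.succ_le_succ ih).trans (ho.succ_le _)

variable {k : Type*} [Field k] {G : Type*} [CommRing G] [Algebra k G] {b : Module.Basis S k G}

theorem IsMonomialBasis.pow_eq (hb : IsMonomialBasis o b) (ho : IsOrderFunction S o m) (n : ℕ) :
    b m ^ n = b (n • m) := by
  induction n with
  | zero => simp [hb.basis_zero]
  | succ n ih =>
    rw [pow_succ, ih, hb.mul_of_eq, ← succ_nsmul]
    rw [← succ_nsmul, ho.map_nsmul, ho.map_nsmul, ho.map_mult]

/-- Beyond `N + m` each basis element is `b m` times an earlier one, so the finitely many below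
generate over `k[X]`, with `X` acting as `b m`. -/
theorem IsMonomialBasis.finite (hb : IsMonomialBasis o b) (ho : IsOrderFunction S o m) :
    (aeval (R := k) (b m)).toRingHom.Finite := by
  obtain ⟨N, hN⟩ := ho.exists_forall_ge
  let _ : Algebra k[X] G := (aeval (R := k) (b m)).toRingHom.toAlgebra
  have hfin : ((fun s : S => b s) '' {s | (s : ℕ) < N + m}).Finite :=
    ((Set.finite_lt_nat (N + m)).preimage Subtype.val_injective.injOn).image _
  refine Module.finite_def.2 ⟨hfin.toFinset, ?_⟩
  rw [hfin.coe_toFinset, eq_top_iff]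
  have hsmul (f : k[X]) (g : G) : f • g = aeval (R := k) (b m) f * g := rfl
  have hbasis (n : ℕ) : ∀ hn : n ∈ S, b ⟨n, hn⟩ ∈
      Submodule.span k[X] ((fun s : S => b s) '' {s | (s : ℕ) < N + m}) := by
    induction n using Nat.strong_induction_on with
    | _ n ih =>
      intro hn
      by_cases hlt : n < N + m
      · exact Submodule.subset_span ⟨⟨n, hn⟩, hlt, rfl⟩
      · obtain ⟨hmem, heq⟩ := hN (n - m) (by omega)
        have hpos : (m : ℕ) ≠ 0 := fun h => ho.ne_zero (Subtype.ext h)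
        have hsum : (⟨n - m, hmem⟩ + m : S) = ⟨n, hn⟩ := Subtype.ext (by
          simp only [AddSubmonoid.coe_add]
          omega)
        have h1 : b ⟨n, hn⟩ = (X : k[X]) • b ⟨n - m, hmem⟩ := by
          rw [hsmul, aeval_X, mul_comm, hb.mul_of_eq, hsum]
          rw [ho.map_mult]
          exact heq
        rw [h1]
        exact Submodule.smul_mem _ _ (ih (n - m) (by omega) hmem)
  intro g _
  induction b.mem_span g using Submodule.span_induction with
  | mem _ h => obtain ⟨s, rfl⟩ := h; exact hbasis s s.2
  | zero => exact zero_mem _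
  | add _ _ _ _ h1 h2 => exact add_mem (h1 trivial) (h2 trivial)
  | smul c y _ h =>
    have : c • y = (C c : k[X]) • y := by rw [hsmul, aeval_C, Algebra.smul_def]
    rw [this]
    exact Submodule.smul_mem _ _ (h trivial)

theorem IsMonomialBasis.isNoetherianRing (hb : IsMonomialBasis o b)
    (ho : IsOrderFunction S o m) : IsNoetherianRing G := by
  let _ : Algebra k[X] G := (aeval (R := k) (b m)).toRingHom.toAlgebra
  have : Module.Finite k[X] G := hb.finite ho
  exact IsNoetherianRing.of_finite k[X] G

theorem IsMonomialBasis.ringKrullDim_le (hb : IsMonomialBasis o b)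
    (ho : IsOrderFunction S o m) : ringKrullDim G ≤ 1 := by
  let _ : Algebra k[X] G := (aeval (R := k) (b m)).toRingHom.toAlgebra
  have : Module.Finite k[X] G := hb.finite ho
  exact (ringKrullDim_le_of_isIntegral k[X] G).trans
    (IsPrincipalIdealRing.ringKrullDim_eq_one k[X] (not_isField k)).le

/-- By integrality a maximal ideal contracts to a maximal ideal of `k[X]`, which is nonzero. This
supplies the regular element at every maximal ideal, not only the graded one. -/
theorem IsMonomialBasis.exists_aeval_mem (hb : IsMonomialBasis o b)
    (ho : IsOrderFunction S o m) (p : Ideal G) [p.IsMaximal] :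
    ∃ f : k[X], f ≠ 0 ∧ aeval (b m) f ∈ p := by
  let _ : Algebra k[X] G := (aeval (R := k) (b m)).toRingHom.toAlgebra
  have : Module.Finite k[X] G := hb.finite ho
  have hmax := Ideal.isMaximal_comap_of_isIntegral_of_isMaximal (R := k[X]) p
  obtain ⟨f, hf, hf0⟩ := Submodule.exists_mem_ne_zero_of_ne_bot
    (Ring.ne_bot_of_isMaximal_of_not_isField hmax (not_isField k))
  exact ⟨f, hf0, hf⟩

theorem IsMonomialBasis.repr_mul_add (hb : IsMonomialBasis o b) (t : S)
    (h : ∀ s : S, o (s + t : S) = o s + o t) (s : S) (g : G) :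
    b.repr (b t * g) (t + s) = b.repr g s := by
  have : (Finsupp.lapply (t + s)) ∘ₗ b.repr.toLinearMap ∘ₗ LinearMap.mulLeft k (b t) =
      (Finsupp.lapply s) ∘ₗ b.repr.toLinearMap := by
    refine b.ext fun u => ?_
    have h1 : b t * b u = b (t + u) := hb.mul_of_eq t u (by rw [add_comm t u, h u, add_comm])
    simp [h1, Finsupp.single_apply]
  exact LinearMap.congr_fun this g

theorem IsMonomialBasis.repr_mul_eq_zero (hb : IsMonomialBasis o b) {s t : S}
    (h : (s : ℕ) < t) (g : G) : b.repr (b t * g) s = 0 := by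
  have : (Finsupp.lapply s) ∘ₗ b.repr.toLinearMap ∘ₗ LinearMap.mulLeft k (b t) =
      (0 : G →ₗ[k] k) := by
    refine b.ext fun u => ?_
    have hne : t + u ≠ s := fun h' => by
      have := congrArg Subtype.val h'
      simp only [AddSubmonoid.coe_add] at this
      omega
    by_cases h1 : o (t + u : S) = o t + o u
    · simp [hb.mul_of_eq t u h1, hne]
    · simp [hb.mul_of_ne t u h1]
  exact LinearMap.congr_fun this g

/-- Multiplication by `b m` is injective, so powers of `X` can be stripped from `f`. What remains
has invertible constant term, whence `g = b m * (w * g)` for some `w`; iterating, `g` is divisible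
by every power of `b m`, and only zero is. -/
theorem IsMonomialBasis.aeval_mul_eq_zero (hb : IsMonomialBasis o b)
    (ho : IsOrderFunction S o m) (h : ∀ s : S, o (s + m : S) = o s + 1) {f : k[X]} (hf : f ≠ 0)
    {g : G} (hg : aeval (b m) f * g = 0) : g = 0 := by
  have hinj (g : G) (hg : b m * g = 0) : g = 0 := by
    refine b.repr.map_eq_zero_iff.1 (Finsupp.ext fun s => ?_)
    rw [← hb.repr_mul_add m (by simpa [ho.map_mult] using h), hg]
    simp
  have hinj' (n : ℕ) (g : G) (hg : b m ^ n * g = 0) : g = 0 := by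
    induction n with
    | zero => simpa using hg
    | succ n ih =>
      rw [pow_succ', mul_assoc] at hg
      exact ih (hinj _ hg)
  obtain ⟨q, hq, hndvd⟩ := exists_eq_pow_rootMultiplicity_mul_and_not_dvd f hf 0
  rw [map_zero, sub_zero] at hq hndvd
  rw [X_dvd_iff] at hndvd
  rw [hq, map_mul, map_pow, aeval_X, mul_assoc] at hg
  replace hg := hinj' _ _ hg
  rw [← divX_mul_X_add q, map_add, map_mul, aeval_X, aeval_C, add_mul, ← Algebra.smul_def] at hg
  set w : G := -((q.coeff 0)⁻¹ • aeval (b m) q.divX) with hw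
  have h1 : g = b m * (w * g) := by
    have h2 := congrArg (fun y => (q.coeff 0)⁻¹ • y) hg
    simp only [smul_add, smul_smul, inv_mul_cancel₀ hndvd, one_smul, smul_zero] at h2
    rw [eq_neg_of_add_eq_zero_right h2, hw]
    conv_rhs => rw [← eq_neg_of_add_eq_zero_right h2]
    simp only [neg_mul, mul_neg, smul_mul_assoc, mul_smul_comm]
    ring_nf
  have h3 (n : ℕ) : g = b m ^ n * (w ^ n * g) := by
    induction n with
    | zero => simp
    | succ n ih =>
      rw [pow_succ, pow_succ, mul_assoc, mul_assoc, mul_left_comm (b m), ← h1]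
      exact ih
  refine b.repr.map_eq_zero_iff.1 (Finsupp.ext fun s => ?_)
  -- The exponent `s + 1` is large enough: `(s + 1) * m > s`, so the coefficient at `s` vanishes.
  rw [h3 (s + 1), hb.pow_eq ho]
  refine hb.repr_mul_eq_zero ?_ _
  have hpos : (m : ℕ) ≠ 0 := fun h => ho.ne_zero (Subtype.ext h)
  simp only [AddSubmonoidClass.coe_nsmul, smul_eq_mul]
  nlinarith [Nat.pos_of_ne_zero hpos]

theorem IsMonomialBasis.isCohenMacaulayRing (hb : IsMonomialBasis o b)
    (ho : IsOrderFunction S o m) (h : ∀ s : S, o (s + m : S) = o s + 1) :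
    IsCohenMacaulayRing G := by
  have := hb.isNoetherianRing ho
  refine isCohenMacaulayRing_iff.2 ⟨this, fun p hp => ?_⟩
  obtain ⟨f, hf, hfp⟩ := hb.exists_aeval_mem ho p
  have : IsNoetherianRing (Localization.AtPrime p) :=
    IsLocalization.isNoetherianRing p.primeCompl _ this
  refine depth_eq_ringKrullDim_of_isSMulRegular
    ((ringKrullDim_localization_le p).trans (hb.ringKrullDim_le ho))
    (y := algebraMap G _ (aeval (b m) f)) ?_ ?_
  · exact (IsLocalization.AtPrime.to_map_mem_maximal_iff _ p _).2 hfp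
  · refine isSMulRegular_iff_right_eq_zero_of_smul.2 fun y hy => ?_
    obtain ⟨⟨g, u⟩, hgu⟩ := IsLocalization.surj p.primeCompl y
    have h1 : algebraMap G (Localization.AtPrime p) (aeval (b m) f * g) = 0 := by
      rw [map_mul, ← hgu, ← mul_assoc, ← smul_eq_mul (algebraMap _ _ _), hy, zero_mul]
    obtain ⟨v, hv⟩ := (IsLocalization.map_eq_zero_iff p.primeCompl _ _).1 h1
    have h2 : (v : G) * g = 0 := hb.aeval_mul_eq_zero ho h hf (by rw [← hv]; ring)
    have h3 : algebraMap G (Localization.AtPrime p) g = 0 :=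
      (IsLocalization.map_eq_zero_iff p.primeCompl _ _).2 ⟨v, h2⟩
    rw [h3] at hgu
    exact (IsLocalization.map_units _ u).mul_left_eq_zero.1 hgu

/-- The augmentation whose kernel is the ideal of the elements of positive degree. -/
noncomputable def IsMonomialBasis.augmentation (hb : IsMonomialBasis o b) :
    G →ₐ[k] k :=
  AlgHom.ofLinearMap (b.coord 0) (by rw [← hb.basis_zero]; simp) (by
    -- Multiplicativity is checked on basis elements: `s + t = 0` in `S` forces `s = t = 0`.
    have : (LinearMap.mul k G).compr₂ (b.coord 0) =
        (LinearMap.mul k k).compl₁₂ (b.coord 0) (b.coord 0) := by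
      refine b.ext fun s => b.ext fun t => ?_
      by_cases h1 : s = 0
      · subst h1
        have h2 : b.repr 1 0 = 1 := by rw [← hb.basis_zero]; simp
        simp [hb.basis_zero, h2]
      · have h2 : s + t ≠ 0 := fun h => h1 (Subtype.ext (by
          have := congrArg Subtype.val h
          simp only [AddSubmonoid.coe_add, AddSubmonoid.coe_zero] at this ⊢
          omega))
        by_cases h3 : o (s + t : S) = o s + o t
        · simp [hb.mul_of_eq s t h3, h1, h2]
        · simp [hb.mul_of_ne s t h3, h1]
    exact fun x y => LinearMap.congr_fun₂ this x y)

theorem IsMonomialBasis.augmentation_apply (hb : IsMonomialBasis o b) (g : G) :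
    hb.augmentation g = b.repr g 0 := rfl

/-- If `b t * b s` were nonzero with `t ≠ 0`, then `o (t + s + m) ≥ o t + o (s + m) ≥ o (t + s) +
2`, so `t + s` would be a failure larger than `s`. Thus `b s` is a socle element. -/
theorem IsMonomialBasis.mul_eq_smul_of_maximal (hb : IsMonomialBasis o b)
    (ho : IsOrderFunction S o m) {s : S} (hs : o (s + m : S) ≠ o s + 1)
    (hmax : ∀ t : S, o (t + m : S) ≠ o t + 1 → (t : ℕ) ≤ s) (g : G) :
    g * b s = hb.augmentation g • b s := by
  have : LinearMap.mulRight k (b s) =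
      (LinearMap.toSpanSingleton k G (b s)) ∘ₗ (hb.augmentation).toLinearMap := by
    refine b.ext fun t => ?_
    by_cases ht : t = 0
    · subst ht
      simp [hb.augmentation_apply, hb.basis_zero]
      simp [← hb.basis_zero]
    · have ht' : (t : ℕ) ≠ 0 := fun h => ht (Subtype.ext h)
      have h1 : o (t + s : S) ≠ o t + o s := fun h => by
        have h2 := ho.succ_le s
        have h3 := ho.add_le t (s + m)
        rw [← add_assoc] at h3
        have h4 := hmax (t + s) (by omega)
        simp only [AddSubmonoid.coe_add] at h4
        omega
      simp [hb.augmentation_apply, hb.mul_of_ne t s h1, ht]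
  exact LinearMap.congr_fun this g

theorem IsMonomialBasis.eq_succ_of_isCohenMacaulayRing (hb : IsMonomialBasis o b)
    (ho : IsOrderFunction S o m) (h : IsCohenMacaulayRing G) (s : S) :
    o (s + m : S) = o s + 1 := by
  by_contra hs
  obtain ⟨N, hN⟩ := ho.exists_forall_ge
  obtain ⟨s, hs, hmax⟩ : ∃ s : S, o (s + m : S) ≠ o s + 1 ∧
      ∀ t : S, o (t + m : S) ≠ o t + 1 → (t : ℕ) ≤ s := by
    have hfin : {s : S | o (s + m : S) ≠ o s + 1}.Finite :=
      ((Set.finite_lt_nat N).preimage Subtype.val_injective.injOn).subset fun t ht => by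
        by_contra hlt
        exact ht (hN t (not_lt.1 hlt)).2
    obtain ⟨t, ht⟩ := hfin.exists_maximal ⟨s, hs⟩
    exact ⟨t, ht.1, fun u hu => not_lt.1 fun hlt =>
      absurd (ht.2 hu (le_of_lt (show t < u from hlt))) (not_le_of_gt (show t < u from hlt))⟩
  set ε := hb.augmentation with hε
  let p : Ideal G := RingHom.ker ε
  have hp : p.IsMaximal := RingHom.ker_isMaximal_of_surjective ε fun c =>
    ⟨algebraMap k G c, by simp⟩
  have hsoc := hb.mul_eq_smul_of_maximal ho hs hmax
  have hmemp (g : G) : g ∈ p ↔ ε g = 0 := RingHom.mem_ker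
  have hz : algebraMap G (Localization.AtPrime p) (b s) ≠ 0 := fun h0 => by
    obtain ⟨u, hu⟩ := (IsLocalization.map_eq_zero_iff p.primeCompl _ _).1 h0
    rw [hsoc] at hu
    exact u.2 ((hmemp _).2 ((smul_eq_zero.1 hu).resolve_right (b.ne_zero s)))
  have hdepth : depth (Localization.AtPrime p) (Localization.AtPrime p) = 0 := by
    refine depth_eq_zero_of_mul_eq_zero hz fun y hy => ?_
    obtain ⟨⟨g, u⟩, hgu⟩ := IsLocalization.surj p.primeCompl y
    have hg : g ∈ p := by
      rw [← IsLocalization.AtPrime.to_map_mem_maximal_iff (Localization.AtPrime p) p, ← hgu]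
      exact Ideal.mul_mem_right _ _ hy
    refine (IsLocalization.map_units _ u).mul_left_eq_zero.1 ?_
    rw [mul_right_comm, hgu, ← map_mul, hsoc, (hmemp g).1 hg, zero_smul, map_zero]
  have hdim := (isCohenMacaulayRing_iff.1 h).2 p
  rw [hdepth] at hdim
  -- Depth zero forces dimension zero, so `b m` becomes nilpotent in the localization: some `u ∉ p`
  -- kills `b (n • m)`. But the coefficient of `u * b (n • m)` at `n • m` is `ε u`, so `u ∈ p`.
  have : Ring.KrullDimLE 0 (Localization.AtPrime p) :=
    ringKrullDimZero_iff_ringKrullDim_eq_zero.2 hdim.symm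
  have hx : algebraMap G (Localization.AtPrime p) (b m) ∈
      IsLocalRing.maximalIdeal (Localization.AtPrime p) := by
    rw [IsLocalization.AtPrime.to_map_mem_maximal_iff _ p, hmemp, hε, hb.augmentation_apply]
    simp [ho.ne_zero]
  obtain ⟨n, hn⟩ := Ring.KrullDimLE.isNilpotent_iff_mem_maximalIdeal.2 hx
  rw [← map_pow, IsLocalization.map_eq_zero_iff p.primeCompl] at hn
  obtain ⟨u, hu⟩ := hn
  refine u.2 ((hmemp _).2 ?_)
  have key : (Finsupp.lapply (n • m)) ∘ₗ b.repr.toLinearMap ∘ₗ LinearMap.mulRight k (b (n • m)) =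
      ε.toLinearMap := by
    refine b.ext fun t => ?_
    by_cases ht : t = 0
    · subst ht
      simp [hε, hb.augmentation_apply, hb.basis_zero]
      simp [← hb.basis_zero]
    · by_cases h1 : o (t + n • m : S) = o t + o (n • m : S)
      · simp [hε, hb.augmentation_apply, hb.mul_of_eq t _ h1, ht]
      · simp [hε, hb.augmentation_apply, hb.mul_of_ne t _ h1, ht]
  rw [hb.pow_eq ho] at hu
  have := LinearMap.congr_fun key (u : G)
  simpa [hu] using this.symm

theorem IsMonomialBasis.isCohenMacaulayRing_iff (hb : IsMonomialBasis o b)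
    (ho : IsOrderFunction S o m) :
    IsCohenMacaulayRing G ↔ ∀ s : S, o (s + m : S) = o s + 1 :=
  ⟨hb.eq_succ_of_isCohenMacaulayRing ho, hb.isCohenMacaulayRing ho⟩

end MonomialBasis
end TangentCone

namespace TangentCone

/-! ### The order function of a numerical semigroup -/

section Order

variable (S : AddSubmonoid ℕ)

/-- The `n`-th power `nM` of the maximal ideal `M = S \ {0}` of `S`. -/
def maximalIdealPow : ℕ → Set ℕ
  | 0 => S
  | n + 1 => {x | ∃ a ∈ S, a ≠ 0 ∧ ∃ y ∈ maximalIdealPow n, a + y = x}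

/-- The order of `s`: the largest `n` such that `s` lies in the `n`-th power of the maximal ideal
of `S`. -/
noncomputable def order (s : ℕ) : ℕ := sSup {n | s ∈ maximalIdealPow S n}

variable {S}

theorem maximalIdealPow_subset (n : ℕ) : maximalIdealPow S n ⊆ S := by
  induction n with
  | zero => exact subset_rfl
  | succ n ih =>
    rintro _ ⟨a, ha, -, y, hy, rfl⟩
    exact S.add_mem ha (ih hy)

theorem add_mem_maximalIdealPow {n l x y : ℕ} (hx : x ∈ maximalIdealPow S n)
    (hy : y ∈ maximalIdealPow S l) : x + y ∈ maximalIdealPow S (n + l) := by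
  induction n generalizing x with
  | zero =>
    rw [zero_add]
    cases l with
    | zero => exact S.add_mem hx hy
    | succ l =>
      obtain ⟨a, ha, ha0, z, hz, rfl⟩ := hy
      induction l generalizing a z x with
      | zero => exact ⟨a, ha, ha0, x + z, S.add_mem hx hz, by ring⟩
      | succ l ih =>
        obtain ⟨a', ha', ha0', z', hz', rfl⟩ := hz
        exact ⟨a, ha, ha0, x + (a' + z'), ih hx a' ha' ha0' z' hz', by ring⟩
  | succ n ih =>
    obtain ⟨a, ha, ha0, z, hz, rfl⟩ := hx
    rw [Nat.succ_add]
    exact ⟨a, ha, ha0, z + y, ih hz, by ring⟩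

theorem maximalIdealPow_succ_subset (n : ℕ) : maximalIdealPow S (n + 1) ⊆ maximalIdealPow S n := by
  rintro _ ⟨a, ha, -, y, hy, rfl⟩
  have := add_mem_maximalIdealPow (n := 0) ha hy
  rwa [zero_add] at this

theorem maximalIdealPow_antitone : Antitone (maximalIdealPow S) :=
  antitone_nat_of_succ_le maximalIdealPow_succ_subset

theorem mul_le_of_mem_maximalIdealPow {m : ℕ} (hm : ∀ s ∈ S, s ≠ 0 → m ≤ s) {n x : ℕ}
    (hx : x ∈ maximalIdealPow S n) : m * n ≤ x := by
  induction n generalizing x with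
  | zero => simp
  | succ n ih =>
    obtain ⟨a, ha, ha0, y, hy, rfl⟩ := hx
    have h1 := hm a ha ha0
    have h2 := ih hy
    rw [mul_add]
    omega

theorem le_order_iff {s n : ℕ} (hs : s ∈ S) : n ≤ order S s ↔ s ∈ maximalIdealPow S n := by
  -- Boundedness is needed because `sSup` of an unbounded set of naturals is `0`. Nonzero elements
  -- are at least `1`, so `n ≤ s`.
  have hbdd : BddAbove {n | s ∈ maximalIdealPow S n} := ⟨s, fun n hn => by
    simpa using mul_le_of_mem_maximalIdealPow (m := 1) (fun a _ ha => Nat.pos_of_ne_zero ha) hn⟩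
  constructor
  · intro h
    exact maximalIdealPow_antitone h (Nat.sSup_mem (s := {n | s ∈ maximalIdealPow S n})
      ⟨0, hs⟩ hbdd)
  · exact fun h => le_csSup hbdd h

theorem order_add_le {s t : ℕ} (hs : s ∈ S) (ht : t ∈ S) :
    order S s + order S t ≤ order S (s + t) :=
  (le_order_iff (S.add_mem hs ht)).2
    (add_mem_maximalIdealPow ((le_order_iff hs).1 le_rfl) ((le_order_iff ht).1 le_rfl))

theorem mul_order_le {m : ℕ} (hm : ∀ s ∈ S, s ≠ 0 → m ≤ s) {s : ℕ} (hs : s ∈ S) :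
    m * order S s ≤ s :=
  mul_le_of_mem_maximalIdealPow hm ((le_order_iff hs).1 le_rfl)

theorem one_le_order {s : ℕ} (hs : s ∈ S) (h0 : s ≠ 0) : 1 ≤ order S s :=
  (le_order_iff hs).2 ⟨s, hs, h0, 0, S.zero_mem, rfl⟩

theorem IsNumericalSemigroup.exists_forall_ge (hS : IsNumericalSemigroup S) :
    ∃ c, ∀ n ≥ c, n ∈ S := by
  obtain ⟨c, hc⟩ := hS.bddAbove
  exact ⟨c + 1, fun n hn => by_contra fun h => absurd (hc h) (by omega)⟩

theorem IsNumericalSemigroup.exists_isLeast (hS : IsNumericalSemigroup S) :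
    ∃ m, IsLeast {s | s ∈ S ∧ s ≠ 0} m := by
  obtain ⟨c, hc⟩ := hS.exists_forall_ge
  have h : {s | s ∈ S ∧ s ≠ 0}.Nonempty := ⟨c + 1, hc _ (by omega), by omega⟩
  exact ⟨_, Nat.sInf_mem h, fun _ hs => Nat.sInf_le hs⟩

theorem isOrderFunction_order (hS : IsNumericalSemigroup S) {m : ℕ}
    (hm : IsLeast {s | s ∈ S ∧ s ≠ 0} m) : IsOrderFunction S (order S) ⟨m, hm.1.1⟩ where
  order_zero := by
    simpa using mul_order_le (m := 1) (fun a _ ha => Nat.pos_of_ne_zero ha) S.zero_mem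
  add_le s t := order_add_le s.2 t.2
  ne_zero h := hm.1.2 (congrArg Subtype.val h)
  map_mult := by
    refine le_antisymm ?_ (one_le_order hm.1.1 hm.1.2)
    have := mul_order_le (fun s hs h0 => hm.2 ⟨hs, h0⟩) hm.1.1
    exact Nat.le_of_mul_le_mul_left (this.trans_eq (mul_one m).symm) (Nat.pos_of_ne_zero hm.1.2)
  mul_le s := mul_order_le (fun s hs h0 => hm.2 ⟨hs, h0⟩) s.2
  cofinite := hS.exists_forall_ge

theorem mem_maximalIdealPow_of_ge {c m : ℕ} (hc : ∀ n ≥ c, n ∈ S) (hm : m ∈ S) (hm0 : m ≠ 0)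
    (n : ℕ) : ∀ x ≥ c + n * m, x ∈ maximalIdealPow S n := by
  induction n with
  | zero => exact fun x hx => hc x (by omega)
  | succ n ih =>
    intro x hx
    rw [Nat.succ_mul] at hx
    exact ⟨m, hm, hm0, x - m, ih _ (by omega), by omega⟩

theorem finite_setOf_order_eq (hS : IsNumericalSemigroup S) (n : ℕ) :
    {s : S | order S s = n}.Finite := by
  obtain ⟨c, hc⟩ := hS.exists_forall_ge
  obtain ⟨m, hm⟩ := hS.exists_isLeast
  refine ((Set.finite_lt_nat (c + (n + 1) * m)).preimage Subtype.val_injective.injOn).subset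
    fun s hs => ?_
  by_contra hlt
  have := (le_order_iff s.2).2
    (mem_maximalIdealPow_of_ge hc hm.1.1 hm.1.2 (n + 1) s (not_lt.1 hlt))
  rw [hs] at this
  omega

/-- The nonzero elements of `S` that are needed as first summands are bounded. -/
theorem exists_bound_maximalIdealPow (hS : IsNumericalSemigroup S) :
    ∃ B, ∀ n, ∀ x ∈ maximalIdealPow S (n + 1),
      ∃ a ∈ S, a ≠ 0 ∧ a < B ∧ ∃ y ∈ maximalIdealPow S n, a + y = x := by
  obtain ⟨c, hc⟩ := hS.exists_forall_ge
  obtain ⟨m, hm⟩ := hS.exists_isLeast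
  refine ⟨c + m + 1, ?_⟩
  rintro n _ ⟨a, ha, ha0, y, hy, rfl⟩
  by_cases hlt : a < c + m + 1
  · exact ⟨a, ha, ha0, hlt, y, hy, rfl⟩
  -- A large first summand is replaced by `m`; the rest `a - m` is beyond the conductor bound `c`
  -- and is absorbed into `y`.
  · refine ⟨m, hm.1.1, hm.1.2, by omega, (a - m) + y, ?_, by omega⟩
    have := add_mem_maximalIdealPow (n := 0) (hc (a - m) (by omega)) hy
    rwa [zero_add] at this

end Order

/-! ### Powers of the maximal ideal of `k⟦S⟧` in terms of exponents -/

section SemigroupRing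

variable {k : Type*} [Field k] {S : AddSubmonoid ℕ}

namespace SemigroupRing

theorem toPowerSeries_injective :
    Function.Injective (toPowerSeries : SemigroupRing k S →ₐ[k] k⟦X⟧) :=
  Subtype.val_injective

instance : IsDomain (SemigroupRing k S) :=
  toPowerSeries_injective.isDomain (toPowerSeries (k := k) (S := S)).toRingHom

theorem mem_of_coeff_ne_zero {f : SemigroupRing k S} {n : ℕ}
    (h : PowerSeries.coeff n (toPowerSeries f) ≠ 0) : n ∈ S :=
  by_contra fun hn => h (f.2 n hn)

/-- The power series with coefficients in `S`, as an element of `k⟦S⟧`. -/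
def ofPowerSeries (f : k⟦X⟧) (hf : ∀ n ∉ S, PowerSeries.coeff n f = 0) : SemigroupRing k S :=
  ⟨f, hf⟩

@[simp]
theorem toPowerSeries_ofPowerSeries (f : k⟦X⟧) (hf : ∀ n ∉ S, PowerSeries.coeff n f = 0) :
    toPowerSeries (ofPowerSeries f hf) = f := rfl

variable (k) in
/-- The monomial `tˢ` of `k⟦S⟧`. -/
noncomputable def monomial (s : S) : SemigroupRing k S :=
  ofPowerSeries (PowerSeries.X ^ (s : ℕ)) fun n hn => by
    rw [PowerSeries.coeff_X_pow, if_neg]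
    rintro rfl
    exact hn s.2

@[simp]
theorem toPowerSeries_monomial (s : S) :
    toPowerSeries (monomial k s) = PowerSeries.X ^ (s : ℕ) := rfl

theorem monomial_zero : monomial k (0 : S) = 1 :=
  toPowerSeries_injective (by simp)

theorem monomial_add (s t : S) : monomial k (s + t) = monomial k s * monomial k t :=
  toPowerSeries_injective (by simp [pow_add])

theorem monomial_ne_zero (s : S) : monomial k s ≠ 0 := fun h => by
  have := congrArg toPowerSeries h
  simp at this

theorem mem_maximalIdeal_iff (f : SemigroupRing k S) :
    f ∈ IsLocalRing.maximalIdeal (SemigroupRing k S) ↔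
      PowerSeries.coeff 0 (toPowerSeries f) = 0 := by
  rw [IsLocalRing.mem_maximalIdeal, mem_nonunits_iff, isUnit_iff, not_not,
    PowerSeries.coeff_zero_eq_constantCoeff]

theorem mem_maximalIdealPow_of_mem_pow {n : ℕ} {f : SemigroupRing k S}
    (hf : f ∈ IsLocalRing.maximalIdeal (SemigroupRing k S) ^ n) {x : ℕ}
    (hx : PowerSeries.coeff x (toPowerSeries f) ≠ 0) : x ∈ maximalIdealPow S n := by
  induction n generalizing f x with
  | zero => exact mem_of_coeff_ne_zero hx
  | succ n ih =>
    rw [pow_succ'] at hf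
    induction hf using Submodule.mul_induction_on' generalizing x with
    | mem_mul_mem g hg h hh =>
      rw [map_mul, PowerSeries.coeff_mul] at hx
      obtain ⟨⟨i, j⟩, hij, hne⟩ := Finset.exists_ne_zero_of_sum_ne_zero hx
      rw [Finset.HasAntidiagonal.mem_antidiagonal] at hij
      refine ⟨i, mem_of_coeff_ne_zero (left_ne_zero_of_mul hne), ?_, j,
        ih hh (right_ne_zero_of_mul hne), hij⟩
      rintro rfl
      exact left_ne_zero_of_mul hne ((mem_maximalIdeal_iff g).1 hg)
    | add g _ h _ h1 h2 =>
      rw [map_add, map_add] at hx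
      by_cases hg : PowerSeries.coeff x (toPowerSeries g) = 0
      · exact h2 (by simpa [hg] using hx)
      · exact h1 hg

/-- A series may have infinitely many terms, so the bound `B` on first summands is essential. Each
exponent `x` is assigned one first summand `α x < B`; grouping the terms by this value writes `f` as
a finite sum of `tᵃ * F a`, with the exponents of `F a` in the `n`-th power. -/
theorem mem_pow_of_forall (hS : IsNumericalSemigroup S) {n : ℕ} {f : SemigroupRing k S}
    (hf : ∀ x, PowerSeries.coeff x (toPowerSeries f) ≠ 0 → x ∈ maximalIdealPow S n) :
    f ∈ IsLocalRing.maximalIdeal (SemigroupRing k S) ^ n := by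
  classical
  induction n generalizing f with
  | zero => simp
  | succ n ih =>
    obtain ⟨B, hB⟩ := exists_bound_maximalIdealPow hS
    have hB' (x : ℕ) : ∃ a : ℕ, x ∈ maximalIdealPow S (n + 1) →
        a ∈ S ∧ a ≠ 0 ∧ a < B ∧ ∃ y ∈ maximalIdealPow S n, a + y = x := by
      by_cases hx : x ∈ maximalIdealPow S (n + 1)
      · obtain ⟨a, ha⟩ := hB n x hx
        exact ⟨a, fun _ => ha⟩
      · exact ⟨0, fun h => absurd h hx⟩
    choose α hα using hB'
    let P (a y : ℕ) : Prop := α (y + a) = a ∧ y + a ∈ maximalIdealPow S (n + 1)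
    have hP {a y : ℕ} (h : P a y) : y ∈ maximalIdealPow S n := by
      obtain ⟨-, -, -, z, hz, hyz⟩ := hα _ h.2
      rw [h.1] at hyz
      rwa [show y = z by omega]
    let F (a : ℕ) : SemigroupRing k S := ofPowerSeries
      (PowerSeries.mk fun y => if P a y then PowerSeries.coeff (y + a) (toPowerSeries f) else 0)
      fun y hy => by
        rw [PowerSeries.coeff_mk, if_neg]
        exact fun h => hy (maximalIdealPow_subset n (hP h))
    let T : Finset S := ((Set.finite_lt_nat B).preimage
      (Subtype.val_injective (p := (· ∈ S))).injOn).toFinset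
    have hT (a : S) : a ∈ T ↔ (a : ℕ) < B := by simp [T]
    have hsum : f = ∑ a ∈ T.filter (· ≠ 0), monomial k a * F a := by
      refine toPowerSeries_injective (PowerSeries.ext fun x => ?_)
      have hterm (a : S) : PowerSeries.coeff x (toPowerSeries (monomial k a * F a)) =
          if (a : ℕ) ≤ x ∧ P a (x - a) then PowerSeries.coeff x (toPowerSeries f) else 0 := by
        rw [map_mul, toPowerSeries_monomial, PowerSeries.coeff_X_pow_mul']
        by_cases hax : (a : ℕ) ≤ x
        · simp [F, hax]
        · simp [hax]
      rw [map_sum, map_sum, Finset.sum_congr rfl fun a _ => hterm a]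
      by_cases hx : PowerSeries.coeff x (toPowerSeries f) = 0
      · simp [hx]
      · have hx' := hf x hx
        obtain ⟨h1, h2, h3, y, hy, hxy⟩ := hα x hx'
        rw [Finset.sum_eq_single ⟨α x, h1⟩]
        · rw [if_pos]
          refine ⟨by simp only; omega, ?_⟩
          have : x - α x + α x = x := by omega
          exact ⟨by simp only [this], by simpa only [this] using hx'⟩
        · rintro a - hne
          rw [if_neg]
          rintro ⟨hax, hPa, -⟩
          rw [Nat.sub_add_cancel hax] at hPa
          exact hne (Subtype.ext hPa.symm)
        · intro hnot
          exact absurd (Finset.mem_filter.2 ⟨(hT _).2 h3, fun h => h2 (congrArg Subtype.val h)⟩) hnot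
    rw [hsum, pow_succ']
    refine Ideal.sum_mem _ fun a ha => Ideal.mul_mem_mul ?_ (ih fun y hy => ?_)
    · have h0 : (a : ℕ) ≠ 0 := fun h => (Finset.mem_filter.1 ha).2 (Subtype.ext h)
      rw [mem_maximalIdeal_iff, toPowerSeries_monomial, PowerSeries.coeff_X_pow, if_neg h0.symm]
    · refine hP (a := a) (by_contra fun h => hy ?_)
      simp [F, h]

theorem mem_maximalIdeal_pow_iff (hS : IsNumericalSemigroup S) {n : ℕ} {f : SemigroupRing k S} :
    f ∈ IsLocalRing.maximalIdeal (SemigroupRing k S) ^ n ↔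
      ∀ x, PowerSeries.coeff x (toPowerSeries f) ≠ 0 → x ∈ maximalIdealPow S n :=
  ⟨fun hf _ hx => mem_maximalIdealPow_of_mem_pow hf hx, mem_pow_of_forall hS⟩

theorem monomial_mem_pow_iff (hS : IsNumericalSemigroup S) {n : ℕ} {s : S} :
    monomial k s ∈ IsLocalRing.maximalIdeal (SemigroupRing k S) ^ n ↔ n ≤ order S s := by
  rw [mem_maximalIdeal_pow_iff hS, le_order_iff s.2]
  simp [PowerSeries.coeff_X_pow]

end SemigroupRing

end SemigroupRing
end TangentCone

namespace TangentCone

/-! ### The monomial basis of the tangent cone -/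

section TangentConeBasis

open SemigroupRing

variable {k : Type*} [Field k] {S : AddSubmonoid ℕ}

variable (k) in
/-- The monomial `tˢ` placed in degree `ord s` of the Rees algebra of the maximal ideal. -/
noncomputable def reesMonomial (hS : IsNumericalSemigroup S) (s : S) :
    reesAlgebra (IsLocalRing.maximalIdeal (SemigroupRing k S)) :=
  ⟨Polynomial.monomial (order S s) (monomial k s),
    reesAlgebra.monomial_mem.2 ((monomial_mem_pow_iff hS).2 le_rfl)⟩

theorem coe_reesMonomial (hS : IsNumericalSemigroup S) (s : S) :
    (reesMonomial k hS s : Polynomial (SemigroupRing k S)) =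
      Polynomial.monomial (order S s) (monomial k s) := rfl

theorem mem_reesShift_iff {A : Type*} [CommRing A] (I : Ideal A) (f : reesAlgebra I) :
    f ∈ reesShift I ↔ ∀ i, (f : Polynomial A).coeff i ∈ I ^ (i + 1) := Iff.rfl

variable (k) in
/-- The initial form of the monomial `tˢ`. -/
noncomputable def initialForm (hS : IsNumericalSemigroup S) (s : S) :
    AssocGradedRing (IsLocalRing.maximalIdeal (SemigroupRing k S)) :=
  Ideal.Quotient.mk _ (reesMonomial k hS s)

/-- The coefficient of `tˢ` in degree `ord s`. -/
noncomputable def initialCoeff (s : S) :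
    reesAlgebra (IsLocalRing.maximalIdeal (SemigroupRing k S)) →ₗ[k] k where
  toFun f := PowerSeries.coeff s
    (toPowerSeries ((f : Polynomial (SemigroupRing k S)).coeff (order S s)))
  map_add' f g := by simp
  map_smul' c f := by
    change PowerSeries.coeff s (toPowerSeries
      ((c • (f : Polynomial (SemigroupRing k S))).coeff (order S s))) = _
    simp

theorem initialCoeff_reesMonomial (hS : IsNumericalSemigroup S) (s t : S) :
    initialCoeff t (reesMonomial k hS s) = if s = t then 1 else 0 := by
  change PowerSeries.coeff t (toPowerSeries
    ((Polynomial.monomial (order S s) (monomial k s)).coeff (order S t))) = _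
  rw [Polynomial.coeff_monomial]
  by_cases h : s = t
  · subst h
    simp
  · have h' : (t : ℕ) ≠ s := fun h' => h (Subtype.ext h'.symm)
    rw [if_neg h]
    split_ifs
    · simp [PowerSeries.coeff_X_pow, h']
    · simp

theorem initialCoeff_eq_zero_of_mem {f : reesAlgebra (IsLocalRing.maximalIdeal (SemigroupRing k S))}
    (hf : f ∈ reesShift (IsLocalRing.maximalIdeal (SemigroupRing k S))) (s : S) :
    initialCoeff s f = 0 := by
  by_contra h
  have := (le_order_iff s.2).2 (mem_maximalIdealPow_of_mem_pow (hf (order S s)) h)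
  omega

/-- The functionals `initialCoeff` are dual to the initial forms and vanish on `reesShift`. -/
theorem linearIndependent_initialForm (hS : IsNumericalSemigroup S) :
    LinearIndependent k (initialForm k hS) := by
  classical
  rw [linearIndependent_iff']
  intro T c hc t ht
  have h1 : ∑ s ∈ T, c s • initialForm k hS s =
      Ideal.Quotient.mk (reesShift (IsLocalRing.maximalIdeal (SemigroupRing k S)))
        (∑ s ∈ T, c s • reesMonomial k hS s) := by
    rw [map_sum]
    rfl
  rw [h1, Ideal.Quotient.eq_zero_iff_mem] at hc
  have h2 := initialCoeff_eq_zero_of_mem hc t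
  rw [map_sum, Finset.sum_eq_single t] at h2
  · simpa [initialCoeff_reesMonomial] using h2
  · intro s _ hst
    simp [initialCoeff_reesMonomial, hst]
  · exact fun h => absurd ht h

/-- Only finitely many exponents have order exactly `n`; all other terms of `a` have order above `n`
and vanish modulo the next power. -/
theorem mk_mem_span_initialForm (hS : IsNumericalSemigroup S) (n : ℕ) (a : SemigroupRing k S)
    (ha : a ∈ IsLocalRing.maximalIdeal (SemigroupRing k S) ^ n) :
    (Ideal.Quotient.mk (reesShift (IsLocalRing.maximalIdeal (SemigroupRing k S)))
      ⟨Polynomial.monomial n a, reesAlgebra.monomial_mem.2 ha⟩) ∈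
        Submodule.span k (Set.range (initialForm k hS)) := by
  classical
  let T := (finite_setOf_order_eq hS n).toFinset
  have hT (s : S) : s ∈ T ↔ order S s = n := by simp [T]
  let c (s : S) : k := PowerSeries.coeff s (toPowerSeries a)
  have heq : Ideal.Quotient.mk (reesShift (IsLocalRing.maximalIdeal (SemigroupRing k S)))
      ⟨Polynomial.monomial n a, reesAlgebra.monomial_mem.2 ha⟩ =
      Ideal.Quotient.mk (reesShift (IsLocalRing.maximalIdeal (SemigroupRing k S)))
        (∑ s ∈ T, c s • reesMonomial k hS s) := by
    rw [Ideal.Quotient.eq, mem_reesShift_iff]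
    have hsum : ((∑ s ∈ T, c s • reesMonomial k hS s :
        reesAlgebra (IsLocalRing.maximalIdeal (SemigroupRing k S))) :
          Polynomial (SemigroupRing k S)) =
        Polynomial.monomial n (∑ s ∈ T, c s • monomial k s) := by
      rw [map_sum, AddSubmonoidClass.coe_finsetSum]
      refine Finset.sum_congr rfl fun s hs => ?_
      change c s • Polynomial.monomial (order S s) (monomial k s) = _
      rw [(hT s).1 hs, Polynomial.smul_monomial]
    intro i
    rw [AddSubgroupClass.coe_sub, hsum, ← map_sub, Polynomial.coeff_monomial]
    split_ifs with hi
    · subst hi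
      refine mem_pow_of_forall hS fun x hx => ?_
      have hcoeff : PowerSeries.coeff x (toPowerSeries (∑ s ∈ T, c s • monomial k s)) =
          ∑ s ∈ T, if (s : ℕ) = x then c s else 0 := by
        rw [map_sum, map_sum]
        refine Finset.sum_congr rfl fun s _ => ?_
        rw [map_smul, map_smul, toPowerSeries_monomial, PowerSeries.coeff_X_pow]
        simp [eq_comm]
      have hxS : x ∈ S := mem_of_coeff_ne_zero hx
      rw [map_sub, map_sub, hcoeff] at hx
      by_cases hxT : (⟨x, hxS⟩ : S) ∈ T
      · rw [Finset.sum_eq_single ⟨x, hxS⟩] at hx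
        · simp [c] at hx
        · intro s _ hs
          rw [if_neg fun h => hs (Subtype.ext h)]
        · exact fun h => absurd hxT h
      · rw [Finset.sum_eq_zero, sub_zero] at hx
        · have h1 := (le_order_iff hxS).2 (mem_maximalIdealPow_of_mem_pow ha hx)
          have h2 : order S x ≠ n := fun h => hxT ((hT ⟨x, hxS⟩).2 h)
          exact (le_order_iff hxS).1 (by omega)
        · intro s hs
          rw [if_neg]
          rintro rfl
          exact hxT hs
    · exact zero_mem _
  rw [heq, map_sum]
  exact Submodule.sum_mem _ fun s _ =>
    Submodule.smul_mem (Submodule.span k (Set.range (initialForm k hS))) (c s)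
      (Submodule.subset_span (Set.mem_range_self s))

theorem span_initialForm (hS : IsNumericalSemigroup S) :
    ⊤ ≤ Submodule.span k (Set.range (initialForm k hS)) := by
  intro g _
  obtain ⟨f, rfl⟩ := Ideal.Quotient.mk_surjective g
  have : f = ∑ i ∈ (f : Polynomial (SemigroupRing k S)).support,
      (⟨Polynomial.monomial i ((f : Polynomial (SemigroupRing k S)).coeff i),
        reesAlgebra.monomial_mem.2 (f.2 i)⟩ :
          reesAlgebra (IsLocalRing.maximalIdeal (SemigroupRing k S))) := by
    refine Subtype.ext ?_
    rw [AddSubmonoidClass.coe_finsetSum]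
    exact (f : Polynomial (SemigroupRing k S)).as_sum_support
  rw [this, map_sum]
  exact Submodule.sum_mem _ fun i _ => mk_mem_span_initialForm hS i _ (f.2 i)

/-- A basis of an algebra, for the module structure coming from the algebra structure. -/
abbrev AlgebraBasis (ι k G : Type*) [Field k] [CommRing G] [Algebra k G] := Module.Basis ι k G

variable (k) in
/-- The initial forms of the monomials form a basis of the tangent cone. -/
noncomputable def tangentConeBasis (hS : IsNumericalSemigroup S) :
    AlgebraBasis S k (AssocGradedRing (IsLocalRing.maximalIdeal (SemigroupRing k S))) :=
  Module.Basis.mk (linearIndependent_initialForm hS) (span_initialForm hS)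

theorem tangentConeBasis_apply (hS : IsNumericalSemigroup S) (s : S) :
    tangentConeBasis k hS s = initialForm k hS s :=
  Module.Basis.mk_apply _ _ s

theorem isMonomialBasis_tangentConeBasis (hS : IsNumericalSemigroup S) :
    IsMonomialBasis (order S) (tangentConeBasis k hS) := by
  have hmul (s t : S) : ((reesMonomial k hS s * reesMonomial k hS t :
      reesAlgebra (IsLocalRing.maximalIdeal (SemigroupRing k S))) :
        Polynomial (SemigroupRing k S)) =
      Polynomial.monomial (order S s + order S t) (monomial k (s + t)) := by
    rw [MulMemClass.coe_mul, coe_reesMonomial, coe_reesMonomial, Polynomial.monomial_mul_monomial,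
      monomial_add]
  refine ⟨?_, fun s t h => ?_, fun s t h => ?_⟩
  · simp only [tangentConeBasis_apply, initialForm]
    rw [← map_one (Ideal.Quotient.mk _)]
    congr 1
    refine Subtype.ext ?_
    obtain ⟨m, hm⟩ := hS.exists_isLeast
    rw [coe_reesMonomial, AddSubmonoid.coe_zero, (isOrderFunction_order hS hm).order_zero,
      monomial_zero]
    rfl
  · simp only [tangentConeBasis_apply, initialForm]
    rw [← map_mul]
    congr 1
    refine Subtype.ext ?_
    rw [hmul, coe_reesMonomial, h]
  · simp only [tangentConeBasis_apply, initialForm]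
    rw [← map_mul, Ideal.Quotient.eq_zero_iff_mem, mem_reesShift_iff, hmul]
    intro i
    rw [Polynomial.coeff_monomial]
    split_ifs with hi
    · subst hi
      rw [monomial_mem_pow_iff hS]
      have := order_add_le s.2 t.2
      rw [AddSubmonoid.coe_add] at h ⊢
      omega
    · exact zero_mem _

/-- The tangent cone of `k⟦S⟧` is Cohen–Macaulay if and only if adding the multiplicity increases
the order by exactly one. -/
theorem isCohenMacaulayRing_tangentCone_iff (k : Type*) [Field k] (hS : IsNumericalSemigroup S)
    {m : ℕ} (hm : IsLeast {s | s ∈ S ∧ s ≠ 0} m) :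
    IsCohenMacaulayRing (AssocGradedRing (IsLocalRing.maximalIdeal (SemigroupRing k S))) ↔
      ∀ s ∈ S, order S (s + m) = order S s + 1 := by
  rw [(isMonomialBasis_tangentConeBasis (k := k) hS).isCohenMacaulayRing_iff
    (isOrderFunction_order hS hm)]
  exact ⟨fun h s hs => h ⟨s, hs⟩, fun h s => h s s.2⟩

end TangentConeBasis

/-! ### Orders in the numerical duplication -/

section Duplication

variable {S : AddSubmonoid ℕ} {E : AddSemigroupIdeal S} {b e : S}

theorem mem_closure_singleton_iff {x : S} :
    x ∈ AddSemigroupIdeal.closure {e} ↔ ∃ s : S, x = s + e := by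
  rw [AddSemigroupIdeal.mem_closure'']
  simp [eq_comm]

theorem mem_numericalDuplication_iff (hE : E = AddSemigroupIdeal.closure {e}) {n : ℕ} :
    n ∈ numericalDuplication S E b ↔
      (∃ s ∈ S, n = 2 * s) ∨ ∃ s ∈ S, n = 2 * s + (2 * (e : ℕ) + b) := by
  change ((∃ s : S, n = 2 * (s : ℕ)) ∨ ∃ x ∈ E, n = 2 * (x : ℕ) + b) ↔ _
  refine or_congr (by simp) ?_
  subst hE
  constructor
  · rintro ⟨x, hx, rfl⟩
    obtain ⟨s, rfl⟩ := mem_closure_singleton_iff.1 hx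
    exact ⟨s, s.2, by rw [AddSubmonoid.coe_add]; ring⟩
  · rintro ⟨s, hs, rfl⟩
    exact ⟨⟨s, hs⟩ + e, mem_closure_singleton_iff.2 ⟨_, rfl⟩, by
      rw [AddSubmonoid.coe_add]; ring⟩

theorem isNumericalSemigroup_numericalDuplication (hS : IsNumericalSemigroup S)
    (hE : E = AddSemigroupIdeal.closure {e}) (hb : Odd (b : ℕ)) :
    IsNumericalSemigroup (numericalDuplication S E b) := by
  obtain ⟨c, hc⟩ := hS.exists_forall_ge
  obtain ⟨d, hd⟩ := hb
  refine (Set.finite_lt_nat (2 * c + 2 * e + b)).subset fun n hn => ?_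
  by_contra hlt
  simp only [Set.mem_ofPred_eq, not_lt] at hlt
  refine hn ((mem_numericalDuplication_iff hE).2 ?_)
  rcases Nat.even_or_odd' n with ⟨i, rfl | rfl⟩
  · exact Or.inl ⟨i, hc i (by omega), rfl⟩
  · exact Or.inr ⟨i - d - e, hc _ (by omega), by omega⟩

theorem isLeast_numericalDuplication (hE : E = AddSemigroupIdeal.closure {e}) (he : e ≠ 0)
    {m : ℕ} (hm : IsLeast {s | s ∈ S ∧ s ≠ 0} m) :
    IsLeast {s | s ∈ numericalDuplication S E b ∧ s ≠ 0} (2 * m) := by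
  have h0 := hm.1.2
  refine ⟨⟨(mem_numericalDuplication_iff hE).2 (Or.inl ⟨m, hm.1.1, rfl⟩), by omega⟩, ?_⟩
  rintro n ⟨hn, hn0⟩
  rcases (mem_numericalDuplication_iff hE).1 hn with ⟨s, hs, rfl⟩ | ⟨s, hs, rfl⟩
  · have := hm.2 ⟨hs, by omega⟩
    omega
  · have := hm.2 ⟨e.2, fun h => he (Subtype.ext h)⟩
    omega

/-- An element of the second family uses up one summand, through `2e + b`. Two such summands yield
`2 * (s + t + e + (e + b))`, where `e` and `e + b` are two nonzero elements of `S` that make up for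
the loss. At `n = 0` the truncated `n - 1` is `0`, as it should be. -/
theorem mem_maximalIdealPow_numericalDuplication_iff (hE : E = AddSemigroupIdeal.closure {e})
    (he : e ≠ 0) (hb : Odd (b : ℕ)) {n x : ℕ} :
    x ∈ maximalIdealPow (numericalDuplication S E b) n ↔
      (∃ s ∈ maximalIdealPow S n, x = 2 * s) ∨
        ∃ s ∈ maximalIdealPow S (n - 1), x = 2 * s + (2 * (e : ℕ) + b) := by
  have he0 : (e : ℕ) ≠ 0 := fun h => he (Subtype.ext h)
  have hb0 : (b : ℕ) ≠ 0 := fun h => by simp [h] at hb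
  have hmem {n : ℕ} := mem_numericalDuplication_iff (b := b) (n := n) hE
  have hadd {n x y : ℕ} (hx : x ∈ S) (hy : y ∈ maximalIdealPow S n) :
      x + y ∈ maximalIdealPow S n := by
    have := add_mem_maximalIdealPow (n := 0) hx hy
    rwa [zero_add] at this
  induction n generalizing x with
  | zero => exact hmem
  | succ n ih =>
    rw [Nat.add_sub_cancel]
    constructor
    · rintro ⟨a, ha, ha0, y, hy, rfl⟩
      rcases hmem.1 ha with ⟨s, hs, rfl⟩ | ⟨s, hs, rfl⟩ <;>
        rcases ih.1 hy with ⟨t, ht, rfl⟩ | ⟨t, ht, rfl⟩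
      · exact Or.inl ⟨s + t, ⟨s, hs, by omega, t, ht, rfl⟩, by ring⟩
      · refine Or.inr ⟨s + t, ?_, by ring⟩
        -- For `n = 0` the truncated index leaves only membership in `S` to prove; otherwise `s`
        -- raises the power by one.
        cases n with
        | zero => exact S.add_mem hs ht
        | succ n => exact ⟨s, hs, by omega, t, ht, rfl⟩
      · exact Or.inr ⟨s + t, hadd hs ht, by ring⟩
      · refine Or.inl ⟨s + t + (2 * e + b), ?_, by ring⟩
        have h1 : (e : ℕ) + (e + b) + t ∈ maximalIdealPow S (n + 1) := by
          refine maximalIdealPow_antitone (show n + 1 ≤ 2 + (n - 1) by omega)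
            (add_mem_maximalIdealPow ⟨e, e.2, he0, e + b, ⟨e + b, S.add_mem e.2 b.2, by omega,
              0, S.zero_mem, rfl⟩, rfl⟩ ht)
        have h2 := hadd hs h1
        rwa [show s + t + (2 * (e : ℕ) + b) = s + (e + (e + b) + t) by ring]
    · rintro (⟨_, ⟨a, ha, ha0, s, hs, rfl⟩, rfl⟩ | ⟨s, hs, rfl⟩)
      · exact ⟨2 * a, hmem.2 (Or.inl ⟨a, ha, rfl⟩), by omega, 2 * s,
          ih.2 (Or.inl ⟨s, hs, rfl⟩), by ring⟩
      · exact ⟨2 * e + b, hmem.2 (Or.inr ⟨0, S.zero_mem, by ring⟩), by omega, 2 * s,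
          ih.2 (Or.inl ⟨s, hs, rfl⟩), by ring⟩

theorem order_numericalDuplication_two_mul (hE : E = AddSemigroupIdeal.closure {e}) (he : e ≠ 0)
    (hb : Odd (b : ℕ)) {s : ℕ} (hs : s ∈ S) :
    order (numericalDuplication S E b) (2 * s) = order S s := by
  refine eq_of_forall_le_iff fun n => ?_
  rw [le_order_iff ((mem_numericalDuplication_iff hE).2 (Or.inl ⟨s, hs, rfl⟩)), le_order_iff hs,
    mem_maximalIdealPow_numericalDuplication_iff hE he hb]
  obtain ⟨d, hd⟩ := hb
  constructor
  · rintro (⟨t, ht, h⟩ | ⟨t, ht, h⟩)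
    · rwa [show s = t by omega]
    · omega
  · exact fun h => Or.inl ⟨s, h, rfl⟩

theorem order_numericalDuplication_two_mul_add (hE : E = AddSemigroupIdeal.closure {e})
    (he : e ≠ 0) (hb : Odd (b : ℕ)) {s : ℕ} (hs : s ∈ S) :
    order (numericalDuplication S E b) (2 * s + (2 * e + b)) = order S s + 1 := by
  refine eq_of_forall_le_iff fun n => ?_
  rw [le_order_iff ((mem_numericalDuplication_iff hE).2 (Or.inr ⟨s, hs, rfl⟩)),
    ← Nat.sub_le_iff_le_add, le_order_iff hs, mem_maximalIdealPow_numericalDuplication_iff hE he hb]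
  obtain ⟨d, hd⟩ := hb
  constructor
  · rintro (⟨t, ht, h⟩ | ⟨t, ht, h⟩)
    · omega
    · rwa [show s = t by omega]
  · exact fun h => Or.inr ⟨s, h, rfl⟩

theorem isCohenMacaulayRing_tangentCone_numericalDuplication_iff (k : Type*) [Field k]
    (hS : IsNumericalSemigroup S) (hE : E = AddSemigroupIdeal.closure {e}) (he : e ≠ 0)
    (hb : Odd (b : ℕ)) :
    IsCohenMacaulayRing (AssocGradedRing
        (IsLocalRing.maximalIdeal (SemigroupRing k (numericalDuplication S E b)))) ↔
      IsCohenMacaulayRing (AssocGradedRing (IsLocalRing.maximalIdeal (SemigroupRing k S))) := by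
  obtain ⟨m, hm⟩ := hS.exists_isLeast
  rw [isCohenMacaulayRing_tangentCone_iff k hS hm, isCohenMacaulayRing_tangentCone_iff k
    (isNumericalSemigroup_numericalDuplication hS hE hb) (isLeast_numericalDuplication hE he hm)]
  constructor
  · intro h s hs
    have := h (2 * s) ((mem_numericalDuplication_iff hE).2 (Or.inl ⟨s, hs, rfl⟩))
    rwa [← mul_add, order_numericalDuplication_two_mul hE he hb (S.add_mem hs hm.1.1),
      order_numericalDuplication_two_mul hE he hb hs] at this
  · intro h x hx
    rcases (mem_numericalDuplication_iff hE).1 hx with ⟨s, hs, rfl⟩ | ⟨s, hs, rfl⟩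
    · rw [← mul_add, order_numericalDuplication_two_mul hE he hb (S.add_mem hs hm.1.1),
        order_numericalDuplication_two_mul hE he hb hs, h s hs]
    · rw [show 2 * s + (2 * (e : ℕ) + b) + 2 * m = 2 * (s + m) + (2 * e + b) by ring,
        order_numericalDuplication_two_mul_add hE he hb (S.add_mem hs hm.1.1),
        order_numericalDuplication_two_mul_add hE he hb hs, h s hs]

end Duplication
end TangentCone

namespace TangentCone

/-! ### The associated graded module of a free module of rank one -/

section CyclicModule

universe u

variable {A : Type u} [CommRing A] (I : Ideal A) (N : Type u) [AddCommGroup N] [Module A N]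

/-- An element of `N` in degree zero of the Rees module. -/
noncomputable def ReesModule.ofDegreeZero (v : N) : ReesModule I N :=
  ⟨PolynomialModule.single A 0 v, fun i => by
    rw [PolynomialModule.coeff_single, Finsupp.single_apply]
    split_ifs with h
    · subst h
      simp [Ideal.stableFiltration]
    · exact zero_mem _⟩

theorem ReesModule.coeff_smul_ofDegreeZero (r : reesAlgebra I) (v : N) (i : ℕ) :
    (toPolynomialModule I N (r • ofDegreeZero I N v)).coeff i = (r : Polynomial A).coeff i • v := by
  rw [map_smul, Subalgebra.smul_def]
  change ((r : Polynomial A) • PolynomialModule.single A 0 v).coeff i = _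
  rw [PolynomialModule.smul_single_apply]
  simp

theorem mem_pow_smul_top_iff (e : A ≃ₗ[A] N) (n : ℕ) (a : A) :
    a • e 1 ∈ I ^ n • (⊤ : Submodule A N) ↔ a ∈ I ^ n := by
  have h1 : I ^ n • (⊤ : Submodule A N) =
      (I ^ n • (⊤ : Submodule A A)).map (e : A →ₗ[A] N) := by
    rw [Submodule.map_smul'', Submodule.map_top, LinearEquiv.range]
  have h2 : a • e 1 = e a := by rw [← map_smul, smul_eq_mul, mul_one]
  rw [h1, h2, Submodule.mem_map_equiv, e.symm_apply_apply, smul_eq_mul, Ideal.mul_top]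

/-- The associated graded module of a free module of rank one is free of rank one over the
associated graded ring. -/
noncomputable def assocGradedRingEquiv (e : A ≃ₗ[A] N) :
    AssocGradedRing I ≃ₗ[AssocGradedRing I] AssocGradedModule I N :=
  LinearEquiv.ofBijective (LinearMap.toSpanSingleton (AssocGradedRing I) (AssocGradedModule I N)
    (Submodule.Quotient.mk (ReesModule.ofDegreeZero I N (e 1)))) (by
  constructor
  · rw [← LinearMap.ker_eq_bot, LinearMap.ker_eq_bot']
    intro g hg
    obtain ⟨r, rfl⟩ := Ideal.Quotient.mk_surjective g
    rw [LinearMap.toSpanSingleton_apply, assocGradedRing_mk_smul_mk, Submodule.Quotient.mk_eq_zero,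
      mem_reesModuleShift] at hg
    rw [Ideal.Quotient.eq_zero_iff_mem, mem_reesShift_iff]
    intro i
    have := hg i
    rwa [ReesModule.coeff_smul_ofDegreeZero, mem_pow_smul_top_iff] at this
  · intro y
    obtain ⟨f, rfl⟩ := Submodule.Quotient.mk_surjective _ y
    set F := ReesModule.toPolynomialModule I N f with hF
    have hsymm (x : N) : e.symm x • e 1 = x := by
      rw [← map_smul, smul_eq_mul, mul_one, e.apply_symm_apply]
    -- A preimage is found by applying `e.symm` to each coefficient; it lies in the Rees algebra
    -- because `e` matches `Iⁱ` with `Iⁱ N`.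
    let q : Polynomial A := ∑ i ∈ F.coeff.support, Polynomial.monomial i (e.symm (F.coeff i))
    have hq (i : ℕ) : q.coeff i = e.symm (F.coeff i) := by
      simp only [q, Polynomial.finsetSum_coeff, Polynomial.coeff_monomial]
      rw [Finset.sum_ite_eq']
      split_ifs with h
      · rfl
      · rw [Finsupp.notMem_support_iff.1 h, map_zero]
    have hmem : q ∈ reesAlgebra I := fun i => by
      rw [hq, ← mem_pow_smul_top_iff I N e, hsymm]
      exact ReesModule.coeff_mem I N f i
    refine ⟨Ideal.Quotient.mk _ ⟨q, hmem⟩, ?_⟩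
    rw [LinearMap.toSpanSingleton_apply, assocGradedRing_mk_smul_mk, Submodule.Quotient.eq,
      mem_reesModuleShift]
    intro i
    have h1 : (ReesModule.toPolynomialModule I N
        ((⟨q, hmem⟩ : reesAlgebra I) • ReesModule.ofDegreeZero I N (e 1))).coeff i = F.coeff i := by
      rw [ReesModule.coeff_smul_ofDegreeZero]
      exact (congrArg (· • e 1) (hq i)).trans (hsymm _)
    rw [map_sub, sub_eq_add_neg, PolynomialModule.coeff_add, Finsupp.add_apply, h1,
      ← neg_one_smul (reesAlgebra I), neg_one_smul]
    have h2 : (-F).coeff i = -(F.coeff i) := rfl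
    rw [← hF, h2, add_neg_cancel]
    exact zero_mem _)

end CyclicModule

/-! ### Principal monomial ideals -/

section MonomialIdeal

variable (k : Type*) [Field k] {S : AddSubmonoid ℕ}

theorem monomialIdeal_closure_singleton (e : S) :
    monomialIdeal k (AddSemigroupIdeal.closure {e}) = Ideal.span {SemigroupRing.monomial k e} := by
  refine le_antisymm (Ideal.span_le.2 ?_) (Ideal.span_le.2 ?_)
  · rintro f ⟨x, hx, hf⟩
    obtain ⟨s, rfl⟩ := mem_closure_singleton_iff.1 hx
    have : f = SemigroupRing.monomial k (s + e) := SemigroupRing.toPowerSeries_injective hf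
    rw [this, SemigroupRing.monomial_add]
    exact Ideal.mul_mem_left _ _ (Ideal.mem_span_singleton_self _)
  · rintro _ rfl
    exact Ideal.subset_span ⟨e, AddSemigroupIdeal.mem_closure_of_mem rfl, rfl⟩

end MonomialIdeal

end TangentCone

theorem mainTheorem11 (k : Type*) [Field k] (S : AddSubmonoid ℕ)
    (hS : TangentCone.IsNumericalSemigroup S) (E : AddSemigroupIdeal S) (hE : 0 ∉ E)
    (hprin : TangentCone.IsPrincipal E) :
    (TangentCone.IsCohenMacaulayRing (TangentCone.AssocGradedRing
        (IsLocalRing.maximalIdeal (TangentCone.SemigroupRing k S))) →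
      TangentCone.IsCohenMacaulayModule
        (TangentCone.AssocGradedRing
          (IsLocalRing.maximalIdeal (TangentCone.SemigroupRing k S)))
        (TangentCone.AssocGradedModule
          (IsLocalRing.maximalIdeal (TangentCone.SemigroupRing k S))
          (TangentCone.monomialIdeal k E))) ∧
    ∀ b : S, Odd (b : ℕ) →
      (TangentCone.IsCohenMacaulayRing (TangentCone.AssocGradedRing
          (IsLocalRing.maximalIdeal
            (TangentCone.SemigroupRing k (TangentCone.numericalDuplication S E b)))) ↔
        TangentCone.IsCohenMacaulayRing (TangentCone.AssocGradedRing
          (IsLocalRing.maximalIdeal (TangentCone.SemigroupRing k S)))) := by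
  obtain ⟨e, rfl⟩ := hprin
  have he : e ≠ 0 := by
    rintro rfl
    exact hE (AddSemigroupIdeal.mem_closure_of_mem rfl)
  refine ⟨fun h => ?_, fun b hb =>
    TangentCone.isCohenMacaulayRing_tangentCone_numericalDuplication_iff k hS rfl he hb⟩
  rw [TangentCone.monomialIdeal_closure_singleton]
  exact TangentCone.IsCohenMacaulayModule.of_equiv (TangentCone.assocGradedRingEquiv _ _
    (LinearEquiv.toSpanNonzeroSingleton _ _ _ (TangentCone.SemigroupRing.monomial_ne_zero e))) h
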